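/- Let $F$ be a probability distribution on $\mathbb{R}_+=[0,\infty)$ with finite positive mean $\mathbb{E}[C]=\int x\,dF(x)\in(0,\infty)$, where $C$ denotes a random variable with distribution $F$, and let $\{C_{i,j} : 1\le i<j<\infty\}$ be independent random variables, each with distribution $F$, on a common probability space. For $n\ge 2$, let $\mathcal{T}_n$ be the set of all spanning trees of the complete graph $K_n$ on the vertex set $\{1,\dots,n\}$, and let $\pi_n$ be the maximum value of the linear program $$ \text{maximize } \sum_{T\in\mathcal{T}_n}\lambda_T \quad\text{subject to}\quad \sum_{T\in\mathcal{T}_n:\,T\ni\{i,j\}}\lambda_T\le C_{i,j}\ \ (1\le i<j\le n), \qquad \lambda_T\ge 0\ \ (T\in\mathcal{T}_n), $$ that is, the maximum fractional packing of spanning trees of $K_n$ with link capacities $C_{i,j}$ (the maximum rate of an allcast session on this network). Then $$ \lim_{n\to\infty}\frac{\pi_n}{n}=\frac12\,\mathbb{E}[C]\qquad\text{almost surely.} $$ -/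

import Mathlib

open MeasureTheory ProbabilityTheory Filter Topology

/-- The set of all spanning trees of the complete graph on the `n` labelled vertices
`0, 1, …, n - 1`: all trees with vertex set `Fin n`. -/
abbrev SpanningTree (n : ℕ) : Type := {T : SimpleGraph (Fin n) // T.IsTree}

noncomputable instance SpanningTree.instFintype (n : ℕ) : Fintype (SpanningTree n) :=
  Fintype.ofFinite _

open Classical in
/-- `lam` is a feasible fractional packing of spanning trees of the complete graph on `n` vertices
in which the link between `i < j` has capacity `c i j` (only values `c i j` with `i < j < n`
matter). -/
def IsTreePacking (n : ℕ) (c : ℕ → ℕ → ℝ) (lam : SpanningTree n → ℝ) : Prop :=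
  (∀ i j : Fin n, i < j → ∑ T : SpanningTree n with T.1.Adj i j, lam T ≤ c i j) ∧
    ∀ T : SpanningTree n, 0 ≤ lam T

/-- The set of all objective values `∑_T λ_T` of feasible fractional packings. -/
def treePackingValues (n : ℕ) (c : ℕ → ℕ → ℝ) : Set ℝ :=
  {r | ∃ lam : SpanningTree n → ℝ, IsTreePacking n c lam ∧ r = ∑ T, lam T}

/-- The optimal value of the spanning-tree-packing linear program. It is a maximum as soon as
`n ≥ 2` and the capacities are nonnegative, see `isGreatest_treePackingValue`. -/
noncomputable def treePackingValue (n : ℕ) (c : ℕ → ℕ → ℝ) : ℝ :=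
  sSup (treePackingValues n c)

/-- For `n ≥ 2` and nonnegative capacities the linear program attains its maximum, and
`treePackingValue` is that maximum. -/
theorem isGreatest_treePackingValue (n : ℕ) (hn : 2 ≤ n) (c : ℕ → ℕ → ℝ)
    (hc : ∀ i j : ℕ, i < j → j < n → 0 ≤ c i j) :
    IsGreatest (treePackingValues n c) (treePackingValue n c) := by
  classical
  have himg : treePackingValues n c =
      (fun lam : SpanningTree n → ℝ => ∑ T, lam T) '' {lam | IsTreePacking n c lam} := by
    ext r
    constructor
    · rintro ⟨lam, h, rfl⟩
      exact ⟨lam, h, rfl⟩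
    · rintro ⟨lam, h, rfl⟩
      exact ⟨lam, h, rfl⟩
  have hedge : ∀ T : SpanningTree n, ∃ i j : Fin n, i < j ∧ T.1.Adj i j := by
    intro T
    haveI : Nontrivial (Fin n) := Fin.nontrivial_iff_two_le.mpr hn
    obtain ⟨j, hj⟩ := T.2.connected.preconnected.exists_adj_of_nontrivial (⟨0, by omega⟩ : Fin n)
    rcases lt_or_gt_of_ne hj.ne with h | h
    · exact ⟨_, _, h, hj⟩
    · exact ⟨_, _, h, hj.symm⟩
  choose a b hab hadj using hedge
  have hclosed : IsClosed {lam : SpanningTree n → ℝ | IsTreePacking n c lam} := by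
    have : {lam : SpanningTree n → ℝ | IsTreePacking n c lam} =
        (⋂ i : Fin n, ⋂ j : Fin n, ⋂ _ : i < j,
          {lam | ∑ T : SpanningTree n with T.1.Adj i j, lam T ≤ c i j}) ∩
        ⋂ T : SpanningTree n, {lam | 0 ≤ lam T} := by
      ext lam
      simp [IsTreePacking]
    rw [this]
    refine IsClosed.inter ?_ ?_
    · refine isClosed_iInter fun i => isClosed_iInter fun j => isClosed_iInter fun _ => ?_
      exact isClosed_le (by fun_prop) continuous_const
    · exact isClosed_iInter fun T => isClosed_le continuous_const (continuous_apply T)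
  have hsub : {lam : SpanningTree n → ℝ | IsTreePacking n c lam} ⊆
      Set.Icc 0 (fun T => c (a T) (b T)) := by
    intro lam h
    refine ⟨fun T => h.2 T, fun T => ?_⟩
    refine le_trans ?_ (h.1 (a T) (b T) (hab T))
    exact Finset.single_le_sum (f := lam) (fun S _ => h.2 S) (by simp [hadj T])
  have hcomp : IsCompact {lam : SpanningTree n → ℝ | IsTreePacking n c lam} :=
    isCompact_Icc.of_isClosed_subset hclosed hsub
  have hne : {lam : SpanningTree n → ℝ | IsTreePacking n c lam}.Nonempty := by
    refine ⟨0, ⟨fun i j hij => ?_, fun T => le_rfl⟩⟩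
    simpa using hc i j hij j.2
  have hcv : IsCompact (treePackingValues n c) := by
    rw [himg]
    exact hcomp.image (by fun_prop)
  have hnv : (treePackingValues n c).Nonempty := by
    rw [himg]
    exact hne.image _
  exact hcv.isGreatest_sSup hnv

/-!
The upper bound is counting: a spanning tree has `n - 1` edges, so a packing of total weight `r`
uses capacity `(n - 1) r` (`sub_one_mul_sum_le_of_isTreePacking`), and by the strong law of large
numbers the total capacity is asymptotic to `E[C] n² / 2` (`ae_tendsto_sum_capacities`).

For the lower bound no min-max theorem on tree packings is used; a packing is written down. In a
graph where all degrees are at most `D` and all codegrees at least `M`, take for each vertex `v` the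
star at `v` and attach every non-neighbour `u` of `v` through a common neighbour of `u` and `v`.
Choosing the common neighbours in `M` ways that are distinct for each fixed `u`, one gets `M` trees
for each `v`. An edge is used by at most `2 D` of these `n M` trees, so giving each of them weight
`1 / (2 D)` yields a packing of value `n M / (2 D)` (`exists_tree_packing_of_codegree`).

In the random graph with edge probability `p`, Hoeffding's inequality and the Borel–Cantelli lemma
allow `D ≈ p n` and `M ≈ p² n`, so that the value is about `p n / 2`
(`ae_eventually_exists_tree_packing`). Finally let `φ = ∑ r, r 1_{A r}` be a simple function with
`0 ≤ φ x ≤ x` and mean close to `E[C]`. The pairs with `C i j ∈ A r` form a random graph with edge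
probability `F (A r)`, and the combination with coefficients `r` of the packings of these graphs
is a packing within the capacities, of value about `n ∑ r, r F (A r) / 2`
(`ae_eventually_le_treePackingValue`).
-/

/-! ### Packing trees in graphs with large codegrees -/

open Classical in
/-- A finite family of spanning trees with nonnegative weights amounts to a function on the set
of all spanning trees with the same total weight and the same load on every edge. -/
lemma exists_treeWeight_of_family {n : ℕ} {ι : Type*} [Fintype ι] (τ : ι → SpanningTree n)
    (w : ι → ℝ) (hw : ∀ k, 0 ≤ w k) :
    ∃ lam : SpanningTree n → ℝ, (∀ T, 0 ≤ lam T) ∧ ∑ T, lam T = ∑ k, w k ∧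
      ∀ a b : Fin n, ∑ T : SpanningTree n with T.1.Adj a b, lam T =
        ∑ k with (τ k).1.Adj a b, w k := by
  refine ⟨fun T => ∑ k with τ k = T, w k, fun T => Finset.sum_nonneg fun k _ => hw k,
    Finset.sum_fiberwise _ _ _, fun a b => ?_⟩
  simp only [Finset.sum_filter]
  simp_rw [Finset.ite_sum_zero]
  rw [Finset.sum_comm]
  refine Finset.sum_congr rfl fun k _ => ?_
  rw [Finset.sum_eq_single (τ k)]
  · simp
  · intro T _ hT
    simp [hT.symm]
  · simp

/-- The graph joining every vertex to its parent. -/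
def parentGraph {V : Type*} (par : V → V) : SimpleGraph V :=
  SimpleGraph.fromRel fun u w => w = par u

/-- If the parent of `u` is `v` or has parent `v`, for all `u`, then the parent graph is
connected. -/
lemma connected_parentGraph {V : Type*} (par : V → V) (v : V)
    (h : ∀ u, par u = v ∨ par (par u) = v) : (parentGraph par).Connected := by
  have step : ∀ u, (parentGraph par).Reachable u (par u) := by
    intro u
    by_cases hu : u = par u
    · rw [← hu]
    · exact SimpleGraph.Adj.reachable ((SimpleGraph.fromRel_adj _ _ _).2 ⟨hu, Or.inl rfl⟩)
  have hv : ∀ u, (parentGraph par).Reachable u v := by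
    intro u
    rcases h u with h | h
    · exact h ▸ step u
    · exact (step u).trans (h ▸ step (par u))
  exact { preconnected := fun a b => (hv a).trans (hv b).symm, nonempty := ⟨v⟩ }

open Classical in
/-- If all degrees are at most `D` and all codegrees at least `M`, there is a packing of value
`n M / (2 D)`. An edge `{x, y}` is used to link `x` to its parent `y` by all `M` trees centred at
`y`, and by at most one tree centred at each neighbour `v ≠ x` of `y` that is not adjacent to `x`;
there are at most `D - M` such `v`. Hence the edge lies in at most `2 D` trees. -/
lemma exists_tree_packing_of_codegree {n : ℕ} (G : SimpleGraph (Fin n)) (M : ℕ) (D : ℝ)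
    (hD : 0 < D) (hdeg : ∀ a, (G.degree a : ℝ) ≤ D)
    (hcodeg : ∀ a b, a ≠ b → M ≤ (G.neighborFinset a ∩ G.neighborFinset b).card) :
    ∃ lam : SpanningTree n → ℝ, (∀ T, 0 ≤ lam T) ∧ ∑ T, lam T = n * (M / (2 * D)) ∧
      ∀ a b : Fin n, ∑ T : SpanningTree n with T.1.Adj a b, lam T ≤ if G.Adj a b then 1 else 0 := by
  rcases Nat.eq_zero_or_pos M with rfl | hM
  · refine ⟨0, fun _ => le_rfl, by simp, fun a b => ?_⟩
    simp only [Pi.zero_apply, Finset.sum_const_zero]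
    split_ifs <;> norm_num
  have hM' : (0 : ℝ) < M := by exact_mod_cast hM
  -- `e v u t` is the `t`-th of `M` distinct common neighbours of `v` and `u`
  have he : ∀ v u : Fin n, ∃ f : Fin M → Fin n, v ≠ u →
      Function.Injective f ∧ ∀ t, G.Adj v (f t) ∧ G.Adj u (f t) := by
    intro v u
    by_cases h : v = u
    · exact ⟨fun _ => v, fun h' => absurd h h'⟩
    obtain ⟨S, hS, hcard⟩ := Finset.exists_subset_card_eq (hcodeg v u h)
    refine ⟨fun t => S.equivFin.symm (t.cast hcard.symm), fun _ => ⟨?_, fun t => ?_⟩⟩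
    · intro s t hst
      simpa [Fin.ext_iff] using hst
    · have := hS (S.equivFin.symm (t.cast hcard.symm)).2
      simpa using this
  choose e he using he
  let par : Fin n → Fin M → Fin n → Fin n := fun v t u =>
    if u = v ∨ G.Adj v u then v else e v u t
  have hconn : ∀ v t, (parentGraph (par v t)).Connected := by
    intro v t
    refine connected_parentGraph _ v fun u => ?_
    by_cases h : u = v ∨ G.Adj v u
    · left
      simp [par, h]
    · right
      push Not at h
      have := ((he v u h.1.symm).2 t).1
      have h1 : par v t u = e v u t := by simp [par, h]
      rw [h1]
      simp [par, this]
  choose T hTle hT using fun v t => (hconn v t).exists_isTree_le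
  obtain ⟨lam, h0, hsum, hload⟩ := exists_treeWeight_of_family
    (fun k : Fin n × Fin M => (⟨T k.1 k.2, hT k.1 k.2⟩ : SpanningTree n))
    (fun _ => 1 / (2 * D)) (fun _ => by positivity)
  refine ⟨lam, h0, ?_, fun a b => ?_⟩
  · rw [hsum]
    simp only [Finset.sum_const, Finset.card_univ, Fintype.card_prod, Fintype.card_fin,
      nsmul_eq_mul]
    push_cast
    ring
  rw [hload]
  -- an edge `{u, par u}` belongs to `G`, and is either at the centre or between `u` and `e v u t`
  have key : ∀ v t x y, x ≠ y → y = par v t x →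
      G.Adj x y ∧ (v = y ∨ (G.Adj v y ∧ v ≠ x ∧ ¬ G.Adj v x ∧ e v x t = y)) := by
    intro v t x y hne hxy
    by_cases h : x = v ∨ G.Adj v x
    · have hy : y = v := by simp [hxy, par, h]
      subst hy
      exact ⟨(h.resolve_left hne).symm, Or.inl rfl⟩
    · have hy : y = e v x t := by simp [hxy, par, h]
      push Not at h
      have := (he v x h.1.symm).2 t
      rw [← hy] at this
      exact ⟨this.2, Or.inr ⟨this.1, h.1.symm, h.2, hy.symm⟩⟩
  split_ifs with hab
  · -- bound for the number of trees that use the edge from `x` to its parent `y`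
    have half : ∀ x y : Fin n, G.Adj x y →
        (((Finset.univ : Finset (Fin n × Fin M)).filter fun k => y = par k.1 k.2 x).card : ℝ)
          ≤ D := by
      intro x y hxy
      let S := G.neighborFinset y \ insert x (G.neighborFinset x)
      have hsub : ((Finset.univ : Finset (Fin n × Fin M)).filter fun k => y = par k.1 k.2 x) ⊆
          ({y} ×ˢ Finset.univ) ∪
            (S ×ˢ (Finset.univ : Finset (Fin M))).filter fun k => e k.1 x k.2 = y := by
        rintro ⟨v, t⟩ hk
        simp only [Finset.mem_filter, Finset.mem_univ, true_and] at hk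
        rcases (key v t x y hxy.ne hk).2 with h | ⟨h1, h2, h3, h4⟩
        · simp [h]
        · simp [S, h2, h4, h1.symm, G.adj_comm x v, h3]
      have hS : S.card + M ≤ G.degree y := by
        have h1 := hcodeg y x hxy.ne'
        have h2 : S.card ≤ (G.neighborFinset y \ G.neighborFinset x).card :=
          Finset.card_le_card (Finset.sdiff_subset_sdiff le_rfl (Finset.subset_insert _ _))
        have h3 := Finset.card_sdiff_add_card_inter (G.neighborFinset y) (G.neighborFinset x)
        rw [SimpleGraph.card_neighborFinset_eq_degree] at h3
        omega
      have hinj : ((S ×ˢ (Finset.univ : Finset (Fin M))).filter fun k => e k.1 x k.2 = y).card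
          ≤ S.card := by
        refine Finset.card_le_card_of_injOn Prod.fst ?_ ?_
        · intro k hk
          simp only [Finset.coe_filter, Finset.mem_product, Set.mem_ofPred_eq] at hk
          exact hk.1.1
        · rintro ⟨v, t⟩ hk ⟨v', t'⟩ hk' hvv
          simp only [Finset.coe_filter, Finset.mem_product, Set.mem_ofPred_eq] at hk hk' hvv
          subst hvv
          have hne : v ≠ x := by
            have := hk.1.1
            simp only [S, Finset.mem_sdiff, Finset.mem_insert, not_or] at this
            exact this.2.1
          rw [(he v x hne).1 (hk.2.trans hk'.2.symm)]
      have hcard := (Finset.card_le_card hsub).trans (Finset.card_union_le _ _)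
      rw [Finset.card_product, Finset.card_singleton, Finset.card_univ, Fintype.card_fin] at hcard
      have : ((Finset.univ : Finset (Fin n × Fin M)).filter fun k => y = par k.1 k.2 x).card
          ≤ G.degree y := by omega
      exact le_trans (by exact_mod_cast this) (hdeg y)
    have hsub : ((Finset.univ : Finset (Fin n × Fin M)).filter fun k => (T k.1 k.2).Adj a b) ⊆
        (Finset.univ.filter fun k => b = par k.1 k.2 a) ∪
          (Finset.univ.filter fun k => a = par k.1 k.2 b) := by
      rintro ⟨v, t⟩ hk
      simp only [Finset.mem_filter, Finset.mem_univ, true_and] at hk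
      have := ((SimpleGraph.fromRel_adj _ _ _).1 (hTle v t hk)).2
      simpa using this
    have hcard := (Finset.card_le_card hsub).trans (Finset.card_union_le _ _)
    have hcard' : (((Finset.univ : Finset (Fin n × Fin M)).filter
        fun k => (T k.1 k.2).Adj a b).card : ℝ) ≤ 2 * D := by
      have := half a b hab
      have := half b a hab.symm
      have : (((Finset.univ : Finset (Fin n × Fin M)).filter
        fun k => (T k.1 k.2).Adj a b).card : ℝ) ≤ _ := Nat.cast_le.2 hcard
      push_cast at this
      linarith
    rw [Finset.sum_const, nsmul_eq_mul, mul_one_div]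
    exact div_le_one_of_le₀ hcard' (by positivity)
  · rw [Finset.filter_false_of_mem, Finset.sum_empty]
    rintro ⟨v, t⟩ _ hk
    obtain ⟨hne, h | h⟩ := (SimpleGraph.fromRel_adj _ _ _).1 (hTle v t hk)
    · exact hab (key v t a b hne h).1
    · exact hab (key v t b a hne.symm h).1.symm

/-! ### Degrees and codegrees of random graphs -/

lemma iIndepSet_inter_of_disjoint {Ω ι κ : Type*} [MeasurableSpace Ω] {μ : Measure Ω}
    {E : ι → Set Ω} (hE : ∀ i, MeasurableSet (E i)) (h : iIndepSet E μ) {u v : κ → ι}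
    (hu : u.Injective) (hv : v.Injective) (huv : ∀ k l, u k ≠ v l) :
    iIndepSet (fun k => E (u k) ∩ E (v k)) μ := by
  classical
  have hE' := (iIndepSet_iff_meas_biInter hE).1 h
  have hpair : ∀ k, μ (E (u k) ∩ E (v k)) = μ (E (u k)) * μ (E (v k)) := by
    intro k
    have := hE' {u k, v k}
    rwa [Finset.prod_pair (huv k k), Finset.set_biInter_insert, Finset.set_biInter_singleton]
      at this
  rw [iIndepSet_iff_meas_biInter fun k => (hE _).inter (hE _)]
  intro s
  have := hE' (s.image u ∪ s.image v)
  rw [Finset.prod_union, Finset.prod_image hu.injOn, Finset.prod_image hv.injOn] at this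
  · simp_rw [hpair, Finset.prod_mul_distrib]
    rw [← this]
    congr 1
    ext ω
    simp [or_imp, forall_and]
  · rw [Finset.disjoint_left]
    simp only [Finset.mem_image, not_exists, not_and]
    rintro _ ⟨k, _, rfl⟩ l _ hl
    exact huv k l hl.symm

open Classical in
/-- Hoeffding's inequality for the number of occurring events, in both directions, among at most
`n` independent events of probability `p`. -/
lemma measureReal_card_deviation_le {Ω κ : Type*} [MeasurableSpace Ω] {μ : Measure Ω}
    [IsProbabilityMeasure μ] {E : κ → Set Ω} (hE : ∀ k, MeasurableSet (E k))
    (h : iIndepSet E μ) {p : ℝ} (hp : ∀ k, μ.real (E k) = p) (S : Finset κ) {n : ℕ}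
    (hn : 0 < n) (hS : S.card ≤ n) {δ : ℝ} (hδ : 0 < δ) :
    μ.real {ω | S.card * p + δ * n ≤ ((S.filter fun k => ω ∈ E k).card : ℝ)}
        ≤ Real.exp (-(2 * δ ^ 2) * n) ∧
      μ.real {ω | ((S.filter fun k => ω ∈ E k).card : ℝ) ≤ S.card * p - δ * n}
        ≤ Real.exp (-(2 * δ ^ 2) * n) := by
  have hn' : (0 : ℝ) < n := by exact_mod_cast hn
  -- for empty `S` the variance proxy vanishes and Hoeffding's bound is the junk value `exp 0`
  rcases S.eq_empty_or_nonempty with rfl | hne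
  · have : 0 < δ * n := by positivity
    simp [this.not_ge, Real.exp_nonneg]
  have hS' : (S.card : ℝ) ≤ n := by exact_mod_cast hS
  have hS0 : (0 : ℝ) < S.card := by exact_mod_cast hne.card_pos
  let Y : κ → Ω → ℝ := fun k => (E k).indicator fun _ => 1
  have hY : iIndepFun Y μ := h.iIndepFun_indicator
  have hint : ∀ k, μ[Y k] = p := by
    intro k
    rw [← hp k]
    exact integral_indicator_one (hE k)
  have hsub : ∀ k, HasSubgaussianMGF (fun ω => Y k ω - p) ((‖(1 : ℝ) - 0‖₊ / 2) ^ 2) μ := by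
    intro k
    rw [← hint k]
    refine hasSubgaussianMGF_of_mem_Icc (a := 0) (b := 1)
      (measurable_const.indicator (hE k)).aemeasurable (ae_of_all _ fun ω => ?_)
    by_cases hω : ω ∈ E k <;> simp [Y, hω]
  have hcount : ∀ ω, ∑ k ∈ S, (Y k ω - p) = (S.filter fun k => ω ∈ E k).card - S.card * p := by
    intro ω
    simp [Finset.sum_sub_distrib, Y, Set.indicator_apply]
  have hexp : Real.exp (-(δ * n) ^ 2 / (2 * (∑ k ∈ S, (‖(1 : ℝ) - 0‖₊ / 2) ^ 2 : NNReal)))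
      ≤ Real.exp (-(2 * δ ^ 2) * n) := by
    apply Real.exp_le_exp.2
    have : (2 * (∑ k ∈ S, (‖(1 : ℝ) - 0‖₊ / 2) ^ 2 : NNReal) : ℝ) = S.card / 2 := by
      simp
      ring
    rw [this, div_le_iff₀ (by positivity)]
    nlinarith [mul_nonneg (mul_nonneg (sq_nonneg δ) hn'.le) (sub_nonneg.2 hS')]
  constructor
  · have h1 := HasSubgaussianMGF.measure_sum_ge_le_of_iIndepFun
      (hY.comp (fun _ x => x - p) (fun _ => measurable_id.sub_const p))
      (s := S) (fun k _ => hsub k) (ε := δ * n) (by positivity)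
    refine le_trans (le_of_eq ?_) (h1.trans hexp)
    congr 1
    ext ω
    have := hcount ω
    simp only [Set.mem_ofPred_eq, Function.comp_apply, this]
    constructor <;> intro <;> linarith
  · have h1 := HasSubgaussianMGF.measure_sum_ge_le_of_iIndepFun
      (hY.comp (fun _ x => -(x - p)) (fun _ => (measurable_id.sub_const p).neg))
      (s := S) (fun k _ => (hsub k).neg) (ε := δ * n) (by positivity)
    refine le_trans (le_of_eq ?_) (h1.trans hexp)
    congr 1
    ext ω
    have := hcount ω
    simp only [Set.mem_ofPred_eq, Function.comp_apply, Finset.sum_neg_distrib, this]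
    constructor <;> intro <;> linarith

/-- The two distinct numbers `a` and `b` in increasing order. -/
def sortedPair (a b : ℕ) (h : a ≠ b) : {p : ℕ × ℕ // p.1 < p.2} :=
  ⟨(min a b, max a b), min_lt_max.2 h⟩

lemma sortedPair_comm (a b : ℕ) (h : a ≠ b) : sortedPair a b h = sortedPair b a h.symm := by
  simp [sortedPair, min_comm, max_comm]

lemma sortedPair_eq_iff {a b c d : ℕ} (h : a ≠ b) (h' : c ≠ d) :
    sortedPair a b h = sortedPair c d h' ↔ (a = c ∧ b = d) ∨ (a = d ∧ b = c) := by
  simp only [sortedPair, Subtype.mk.injEq, Prod.mk.injEq]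
  omega

/-- The random graph on `n` vertices whose edge `{a, b}` is present when the event attached to
that pair occurs. -/
def eventGraph {Ω : Type*} (E : {p : ℕ × ℕ // p.1 < p.2} → Set Ω) (n : ℕ) (ω : Ω) :
    SimpleGraph (Fin n) where
  Adj a b := ∃ h : (a : ℕ) ≠ b, ω ∈ E (sortedPair a b h)
  symm := ⟨fun a b ⟨h, hω⟩ => ⟨h.symm, by rwa [sortedPair_comm]⟩⟩
  loopless := ⟨fun _ ⟨h, _⟩ => h rfl⟩

open Classical in
/-- All degrees and codegrees of a random graph with independent edges of probability `p` are
close to `p n` and `p² n`, eventually almost surely. The failure probability is at most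
`2 n² exp (-2 δ² n)`, which is summable. -/
lemma ae_eventually_degree_codegree {Ω : Type*} [MeasurableSpace Ω] {μ : Measure Ω}
    [IsProbabilityMeasure μ] {E : {p : ℕ × ℕ // p.1 < p.2} → Set Ω}
    (hE : ∀ k, MeasurableSet (E k)) (h : iIndepSet E μ) {p : ℝ}
    (hp : ∀ k, μ.real (E k) = p) {δ : ℝ} (hδ : 0 < δ) :
    ∀ᵐ ω ∂μ, ∀ᶠ n : ℕ in atTop,
      (∀ a, ((eventGraph E n ω).degree a : ℝ) ≤ (p + δ) * n) ∧
      ∀ a b, a ≠ b → (p ^ 2 - 2 * δ) * n ≤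
        (((eventGraph E n ω).neighborFinset a ∩ (eventGraph E n ω).neighborFinset b).card : ℝ) := by
  have hp0 : 0 ≤ p := by
    rw [← hp ⟨(0, 1), by norm_num⟩]
    positivity
  have hp1 : p ≤ 1 := by
    rw [← hp ⟨(0, 1), by norm_num⟩]
    exact measureReal_le_one
  -- `E₁ a` are the potential edges at `a`, `E₂ a b` the potential common neighbours of `a`, `b`;
  -- `B₁` and `B₂` are the exceptional events
  let E₁ : (a : ℕ) → {c : ℕ // a ≠ c} → Set Ω := fun a c => E (sortedPair a c c.2)
  let E₂ : (a b : ℕ) → {c : ℕ // a ≠ c ∧ b ≠ c} → Set Ω := fun a b c =>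
    E (sortedPair a c c.2.1) ∩ E (sortedPair b c c.2.2)
  let S₁ : (a n : ℕ) → Finset {c : ℕ // a ≠ c} := fun a n => (Finset.range n).subtype _
  let S₂ : (a b n : ℕ) → Finset {c : ℕ // a ≠ c ∧ b ≠ c} := fun a b n =>
    (Finset.range n).subtype _
  let B₁ : ℕ → ℕ → Set Ω := fun n a =>
    {ω | (S₁ a n).card * p + δ * n ≤ (((S₁ a n).filter fun k => ω ∈ E₁ a k).card : ℝ)}
  let B₂ : ℕ → ℕ → ℕ → Set Ω := fun n a b =>
    {ω | (((S₂ a b n).filter fun k => ω ∈ E₂ a b k).card : ℝ) ≤ (S₂ a b n).card * p ^ 2 - δ * n}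
  have hS₁ : ∀ a n, (S₁ a n).card ≤ n := fun a n => by
    simp only [S₁, Finset.card_subtype]
    exact (Finset.card_filter_le _ _).trans (Finset.card_range n).le
  have hS₂ : ∀ a b n, (S₂ a b n).card ≤ n := fun a b n => by
    simp only [S₂, Finset.card_subtype]
    exact (Finset.card_filter_le _ _).trans (Finset.card_range n).le
  have hS₂' : ∀ a b n, n ≤ (S₂ a b n).card + 2 := fun a b n => by
    have hsub : Finset.range n ⊆
        (Finset.range n).filter (fun c => a ≠ c ∧ b ≠ c) ∪ {a, b} := by
      intro c hc
      simp only [Finset.mem_union, Finset.mem_filter, Finset.mem_insert, Finset.mem_singleton]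
      tauto
    have h1 := (Finset.card_le_card hsub).trans (Finset.card_union_le _ _)
    have h2 : ({a, b} : Finset ℕ).card ≤ 2 := Finset.card_le_two
    simp only [S₂, Finset.card_subtype]
    rw [Finset.card_range] at h1
    omega
  have hB₁ : ∀ n a, 0 < n → μ.real (B₁ n a) ≤ Real.exp (-(2 * δ ^ 2) * n) := by
    intro n a hn
    refine (measureReal_card_deviation_le (E := E₁ a) (fun k => hE _) ?_ (fun k => hp _)
      (S₁ a n) hn (hS₁ a n) hδ).1
    refine h.precomp (g := fun c : {c : ℕ // a ≠ c} => sortedPair a c c.2) fun c d hcd => ?_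
    rcases (sortedPair_eq_iff _ _).1 hcd with h | h
    · exact Subtype.ext h.2
    · exact absurd h.1 d.2
  have hB₂ : ∀ n a b, a ≠ b → 0 < n → μ.real (B₂ n a b) ≤ Real.exp (-(2 * δ ^ 2) * n) := by
    intro n a b hab hn
    have hu : Function.Injective
        fun c : {c : ℕ // a ≠ c ∧ b ≠ c} => sortedPair a c c.2.1 := fun c d hcd => by
      rcases (sortedPair_eq_iff _ _).1 hcd with h | h
      · exact Subtype.ext h.2
      · exact absurd h.1 d.2.1
    have hv : Function.Injective
        fun c : {c : ℕ // a ≠ c ∧ b ≠ c} => sortedPair b c c.2.2 := fun c d hcd => by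
      rcases (sortedPair_eq_iff _ _).1 hcd with h | h
      · exact Subtype.ext h.2
      · exact absurd h.1 d.2.2
    have huv : ∀ c d : {c : ℕ // a ≠ c ∧ b ≠ c},
        sortedPair a c c.2.1 ≠ sortedPair b d d.2.2 := by
      intro c d hcd
      rcases (sortedPair_eq_iff _ _).1 hcd with h | h
      · exact hab h.1
      · exact c.2.2 h.2.symm
    have hpE : ∀ c, μ.real (E₂ a b c) = p ^ 2 := fun c => by
      have := (iIndepSet_iff_meas_biInter hE).1 h {sortedPair a c c.2.1, sortedPair b c c.2.2}
      rw [Finset.prod_pair (huv c c), Finset.set_biInter_insert, Finset.set_biInter_singleton]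
        at this
      simp only [E₂]
      rw [measureReal_def, this, ENNReal.toReal_mul, ← measureReal_def, ← measureReal_def, hp, hp,
        sq]
    convert (measureReal_card_deviation_le (E := E₂ a b) (fun k => (hE _).inter (hE _))
      (iIndepSet_inter_of_disjoint hE h hu hv huv) hpE (S₂ a b n) hn (hS₂ a b n) hδ).2
  let B : ℕ → Set Ω := fun n => (⋃ a ∈ Finset.range n, B₁ n a) ∪
    ⋃ q ∈ (Finset.range n ×ˢ Finset.range n).filter (fun q => q.1 ≠ q.2), B₂ n q.1 q.2
  have hB : ∀ n, μ.real (B n) ≤ 2 * ((n : ℝ) ^ 2 * Real.exp (-(2 * δ ^ 2) * n)) := by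
    intro n
    rcases Nat.eq_zero_or_pos n with rfl | hn
    · simp [B]
    have h1 : μ.real (⋃ a ∈ Finset.range n, B₁ n a) ≤ n * Real.exp (-(2 * δ ^ 2) * n) := by
      refine (measureReal_biUnion_finset_le _ _).trans
        ((Finset.sum_le_card_nsmul _ _ _ fun a _ => hB₁ n a hn).trans ?_)
      simp
    have h2 : μ.real (⋃ q ∈ (Finset.range n ×ˢ Finset.range n).filter (fun q => q.1 ≠ q.2),
        B₂ n q.1 q.2) ≤ (n : ℝ) ^ 2 * Real.exp (-(2 * δ ^ 2) * n) := by
      refine (measureReal_biUnion_finset_le _ _).trans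
        ((Finset.sum_le_card_nsmul _ _ _ fun q hq =>
          hB₂ n q.1 q.2 (Finset.mem_filter.1 hq).2 hn).trans ?_)
      rw [nsmul_eq_mul]
      refine mul_le_mul_of_nonneg_right ?_ (Real.exp_nonneg _)
      have : ((Finset.range n ×ˢ Finset.range n).filter fun q => q.1 ≠ q.2).card ≤ n ^ 2 := by
        refine (Finset.card_filter_le _ _).trans ?_
        simp [sq]
      exact_mod_cast this
    have h3 : (n : ℝ) ≤ (n : ℝ) ^ 2 := by
      have : (1 : ℝ) ≤ n := by exact_mod_cast hn
      nlinarith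
    have h4 := mul_le_mul_of_nonneg_right h3 (Real.exp_nonneg (-(2 * δ ^ 2) * n))
    have := measureReal_union_le (μ := μ) (⋃ a ∈ Finset.range n, B₁ n a)
      (⋃ q ∈ (Finset.range n ×ˢ Finset.range n).filter (fun q => q.1 ≠ q.2), B₂ n q.1 q.2)
    simp only [B]
    linarith
  have hsum : ∑' n, μ (B n) ≠ ⊤ := by
    have hs : Summable fun n : ℕ => 2 * ((n : ℝ) ^ 2 * Real.exp (-(2 * δ ^ 2) * n)) :=
      (Real.summable_pow_mul_exp_neg_nat_mul 2 (by positivity)).mul_left 2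
    refine ne_top_of_le_ne_top hs.tsum_ofReal_ne_top (ENNReal.tsum_le_tsum fun n => ?_)
    rw [← ofReal_measureReal (s := B n)]
    exact ENNReal.ofReal_le_ofReal (hB n)
  filter_upwards [ae_eventually_notMem hsum] with ω hω
  have hlarge : ∀ᶠ n : ℕ in atTop, 2 ≤ δ * n :=
    (tendsto_natCast_atTop_atTop.const_mul_atTop hδ).eventually_ge_atTop 2
  filter_upwards [hω, hlarge] with n hn hδn
  simp only [B, Set.mem_union, Set.mem_iUnion, not_or, not_exists, Finset.mem_range,
    Finset.mem_filter, Finset.mem_product] at hn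
  constructor
  · intro a
    have h1 := hn.1 a a.2
    simp only [B₁, Set.mem_ofPred_eq, not_le] at h1
    have h2 : (eventGraph E n ω).degree a ≤
        ((S₁ a n).filter fun k => ω ∈ E₁ a k).card := by
      rw [← SimpleGraph.card_neighborFinset_eq_degree]
      refine Finset.card_le_card_of_surjOn (fun c : {c : ℕ // (a : ℕ) ≠ c} =>
        if h : c.1 < n then (⟨c, h⟩ : Fin n) else a) ?_
      intro b hb
      obtain ⟨hne, hb⟩ : (eventGraph E n ω).Adj a b := by simpa using hb
      exact ⟨⟨b, hne⟩, by simpa [S₁, E₁] using hb, by simp⟩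
    have h3 : ((eventGraph E n ω).degree a : ℝ) ≤ _ := Nat.cast_le.2 h2
    have h4 : ((S₁ a n).card : ℝ) ≤ n := by exact_mod_cast hS₁ a n
    nlinarith [mul_le_mul_of_nonneg_right h4 hp0]
  · intro a b hab
    have hab' : (a : ℕ) ≠ b := fun h => hab (Fin.ext h)
    have h1 := hn.2 (a, b) ⟨⟨a.2, b.2⟩, hab'⟩
    simp only [B₂, Set.mem_ofPred_eq, not_le] at h1
    have h2 : ((S₂ a b n).filter fun k => ω ∈ E₂ a b k).card ≤
        ((eventGraph E n ω).neighborFinset a ∩ (eventGraph E n ω).neighborFinset b).card := by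
      refine Finset.card_le_card_of_injOn (fun c => if h : c.1 < n then (⟨c, h⟩ : Fin n) else a)
        ?_ ?_
      · intro c hc
        simp only [S₂, E₂, Finset.coe_filter, Finset.mem_subtype, Finset.mem_range,
          Set.mem_ofPred_eq] at hc
        simp only [hc.1, dite_true, Finset.coe_inter, Set.mem_inter_iff, Finset.mem_coe,
          SimpleGraph.mem_neighborFinset]
        exact ⟨⟨c.2.1, hc.2.1⟩, ⟨c.2.2, hc.2.2⟩⟩
      · intro c hc d hd hcd
        simp only [S₂, Finset.coe_filter, Finset.mem_subtype, Finset.mem_range,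
          Set.mem_ofPred_eq] at hc hd
        simp only [hc.1, hd.1, dite_true, Fin.mk.injEq] at hcd
        exact Subtype.ext hcd
    have h3 : (((S₂ a b n).filter fun k => ω ∈ E₂ a b k).card : ℝ) ≤ _ := Nat.cast_le.2 h2
    have h4 : (n : ℝ) ≤ (S₂ a b n).card + 2 := by exact_mod_cast hS₂' a b n
    have h5 : p ^ 2 ≤ 1 := pow_le_one₀ hp0 hp1
    nlinarith [mul_le_mul_of_nonneg_right h4 (sq_nonneg p)]

open Classical in
/-- The random graph with independent edges of probability `p` packs `(p / 2 - η) n` spanning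
trees, eventually almost surely. -/
lemma ae_eventually_exists_tree_packing {Ω : Type*} [MeasurableSpace Ω] {μ : Measure Ω}
    [IsProbabilityMeasure μ] {E : {p : ℕ × ℕ // p.1 < p.2} → Set Ω}
    (hE : ∀ k, MeasurableSet (E k)) (h : iIndepSet E μ) {p : ℝ}
    (hp : ∀ k, μ.real (E k) = p) {η : ℝ} (hη : 0 < η) :
    ∀ᵐ ω ∂μ, ∀ᶠ n : ℕ in atTop, ∃ lam : SpanningTree n → ℝ, (∀ T, 0 ≤ lam T) ∧
      (p / 2 - η) * n ≤ ∑ T, lam T ∧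
      ∀ a b : Fin n, ∑ T : SpanningTree n with T.1.Adj a b, lam T ≤
        if (eventGraph E n ω).Adj a b then 1 else 0 := by
  have hp0 : 0 ≤ p := by
    rw [← hp ⟨(0, 1), by norm_num⟩]
    positivity
  have hp1 : p ≤ 1 := by
    rw [← hp ⟨(0, 1), by norm_num⟩]
    exact measureReal_le_one
  rcases hp0.eq_or_lt with hp0 | hp0
  · refine ae_of_all _ fun ω => Eventually.of_forall fun n => ⟨0, fun _ => le_rfl, ?_, ?_⟩
    · rw [← hp0]
      simp only [Pi.zero_apply, Finset.sum_const_zero]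
      nlinarith [Nat.cast_nonneg (α := ℝ) n]
    · intro a b
      simp only [Pi.zero_apply, Finset.sum_const_zero]
      split_ifs <;> norm_num
  -- this choice gives `(p ^ 2 - 2 * δ) / (2 * (p + δ)) ≥ p / 2 - η`
  obtain ⟨δ, hδ, hδη⟩ : ∃ δ : ℝ, 0 < δ ∧ 3 * δ ≤ 2 * η * p :=
    ⟨2 * η * p / 3, by positivity, by linarith⟩
  filter_upwards [ae_eventually_degree_codegree hE h hp hδ] with ω hω
  filter_upwards [hω, eventually_gt_atTop 0] with n hn hn0
  have hn0' : (0 : ℝ) < n := by exact_mod_cast hn0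
  obtain ⟨lam, h1, h2, h3⟩ := exists_tree_packing_of_codegree (eventGraph E n ω)
    ⌈(p ^ 2 - 2 * δ) * n⌉₊ ((p + δ) * n) (by positivity)
    (fun a => by convert hn.1 a) (fun a b hab => Nat.ceil_le.2 (by convert hn.2 a b hab))
  refine ⟨lam, h1, ?_, h3⟩
  rw [h2, mul_comm]
  refine mul_le_mul_of_nonneg_left ?_ hn0'.le
  rw [le_div_iff₀ (by positivity)]
  refine le_trans ?_ (Nat.le_ceil _)
  have : (p / 2 - η) * (2 * (p + δ)) ≤ p ^ 2 - 2 * δ := by nlinarith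
  nlinarith

/-! ### Upper bound: total capacity -/

/-- Every spanning tree has `n - 1` edges, so a packing of total weight `r` uses total capacity
`(n - 1) r`. -/
lemma sub_one_mul_sum_le_of_isTreePacking {n : ℕ} {c : ℕ → ℕ → ℝ} {lam : SpanningTree n → ℝ}
    (h : IsTreePacking n c lam) :
    ((n : ℝ) - 1) * ∑ T, lam T ≤ ∑ j ∈ Finset.range n, ∑ i ∈ Finset.range j, c i j := by
  classical
  let P : Finset (Fin n × Fin n) := Finset.univ.filter fun q => q.1 < q.2
  have hedges : ∀ T : SpanningTree n,
      (n : ℝ) - 1 ≤ ((P.filter fun q => T.1.Adj q.1 q.2).card : ℝ) := by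
    intro T
    have hsub : T.1.edgeFinset ⊆ (P.filter fun q => T.1.Adj q.1 q.2).image fun q => s(q.1, q.2) := by
      intro e
      induction e using Sym2.ind with
      | _ a b =>
        intro hab
        have hab : T.1.Adj a b := by simpa using hab
        simp only [Finset.mem_image, Finset.mem_filter, P, Finset.mem_univ, true_and, Prod.exists]
        rcases lt_or_gt_of_ne hab.ne with hlt | hlt
        · exact ⟨a, b, ⟨hlt, hab⟩, rfl⟩
        · exact ⟨b, a, ⟨hlt, hab.symm⟩, Sym2.eq_swap⟩
    have h1 := (Finset.card_le_card hsub).trans Finset.card_image_le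
    have h2 := T.2.card_edgeFinset
    rw [Fintype.card_fin] at h2
    have h3 : n ≤ (P.filter fun q => T.1.Adj q.1 q.2).card + 1 := by omega
    have h4 : (n : ℝ) ≤ (P.filter fun q => T.1.Adj q.1 q.2).card + 1 := by exact_mod_cast h3
    linarith
  have hP : ∑ q ∈ P, c q.1 q.2 = ∑ j ∈ Finset.range n, ∑ i ∈ Finset.range j, c i j := by
    rw [Finset.sum_filter, ← Finset.univ_product_univ, Finset.sum_product_right, Finset.sum_range]
    refine Finset.sum_congr rfl fun j _ => ?_
    simp only [Fin.lt_def]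
    rw [← Finset.sum_range fun i => if i < (j : ℕ) then c i j else 0, ← Finset.sum_filter]
    congr 1
    ext i
    simp only [Finset.mem_filter, Finset.mem_range]
    have := j.2
    omega
  calc ((n : ℝ) - 1) * ∑ T, lam T
      ≤ ∑ T : SpanningTree n, ((P.filter fun q => T.1.Adj q.1 q.2).card : ℝ) * lam T := by
        rw [Finset.mul_sum]
        exact Finset.sum_le_sum fun T _ => mul_le_mul_of_nonneg_right (hedges T) (h.2 T)
    _ = ∑ q ∈ P, ∑ T : SpanningTree n with T.1.Adj q.1 q.2, lam T := by
        simp only [Finset.sum_filter (s := (Finset.univ : Finset (SpanningTree n)))]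
        rw [Finset.sum_comm]
        refine Finset.sum_congr rfl fun T _ => ?_
        rw [← Finset.sum_filter, Finset.sum_const, nsmul_eq_mul]
    _ ≤ ∑ q ∈ P, c q.1 q.2 := by
        refine Finset.sum_le_sum fun q hq => ?_
        convert h.1 q.1 q.2 (Finset.mem_filter.1 hq).2
    _ = _ := hP

/-- The pairs `i < j` ordered by `j`, then by `i`: those with `j < n` are the first
`n (n - 1) / 2` ones. -/
lemma exists_pair_enumeration :
    ∃ e : ℕ → {p : ℕ × ℕ // p.1 < p.2}, e.Injective ∧ ∀ (g : {p : ℕ × ℕ // p.1 < p.2} → ℝ) (n : ℕ),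
      ∑ k ∈ Finset.range (n.choose 2), g (e k) =
        ∑ j ∈ Finset.range n, ∑ i ∈ Finset.range j, if h : i < j then g ⟨(i, j), h⟩ else 0 := by
  have hsucc : ∀ n : ℕ, (n + 1).choose 2 = n.choose 2 + n := by
    intro n
    rw [Nat.choose_succ_succ' n 1, Nat.choose_one_right, add_comm]
  have hmono : Monotone fun n : ℕ => n.choose 2 := fun a b h => Nat.choose_le_choose 2 h
  have hk : ∀ k : ℕ, ∃ q : {p : ℕ × ℕ // p.1 < p.2}, k = q.1.2.choose 2 + q.1.1 := by
    intro k
    have hex : ∃ j : ℕ, k < (j + 1).choose 2 := ⟨k + 1, by rw [hsucc]; omega⟩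
    classical
    have h1 := Nat.find_spec hex
    have h2 : (Nat.find hex).choose 2 ≤ k := by
      by_contra! hlt
      cases hj : Nat.find hex with
      | zero => simp [hj] at hlt
      | succ j =>
        rw [hj] at hlt
        exact Nat.find_min hex (by omega) hlt
    rw [hsucc] at h1
    exact ⟨⟨(k - (Nat.find hex).choose 2, Nat.find hex), by dsimp only; omega⟩,
      by dsimp only; omega⟩
  choose e he using hk
  have huniq : ∀ q q' : {p : ℕ × ℕ // p.1 < p.2},
      q.1.2.choose 2 + q.1.1 = q'.1.2.choose 2 + q'.1.1 → q = q' := by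
    have hle : ∀ q q' : {p : ℕ × ℕ // p.1 < p.2},
        q.1.2.choose 2 + q.1.1 = q'.1.2.choose 2 + q'.1.1 → q.1.2 ≤ q'.1.2 := by
      intro q q' h
      by_contra! hlt
      have h1 := hmono (show q'.1.2 + 1 ≤ q.1.2 from hlt)
      have h2 := q'.2
      simp only [hsucc] at h1
      omega
    intro q q' h
    have h1 : q.1.2 = q'.1.2 := le_antisymm (hle q q' h) (hle q' q h.symm)
    rw [h1] at h
    exact Subtype.ext (Prod.ext (by omega) h1)
  refine ⟨e, fun k l h => by rw [he k, he l, h], fun g n => ?_⟩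
  induction n with
  | zero => simp
  | succ n ih =>
    rw [hsucc, Finset.sum_range_add, ih, Finset.sum_range_succ _ n]
    congr 1
    refine Finset.sum_congr rfl fun i hi => ?_
    have hi := Finset.mem_range.1 hi
    rw [dif_pos hi, huniq (e (n.choose 2 + i)) ⟨(i, n), hi⟩ (he _).symm]

/-- The strong law of large numbers for the total capacity of the complete graph. -/
lemma ae_tendsto_sum_capacities {Ω : Type*} [MeasurableSpace Ω] {μ : Measure Ω}
    {F : Measure ℝ} (hF_int : Integrable (fun x : ℝ => x) F) {C : ℕ → ℕ → Ω → ℝ}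
    (hC_law : ∀ i j : ℕ, i < j → HasLaw (C i j) F μ)
    (hC_indep : iIndepFun (fun p : {p : ℕ × ℕ // p.1 < p.2} => C p.1.1 p.1.2) μ) :
    ∀ᵐ ω ∂μ, Tendsto (fun n : ℕ => (∑ j ∈ Finset.range n, ∑ i ∈ Finset.range j, C i j ω) /
      (n.choose 2 : ℕ)) atTop (𝓝 (∫ x, x ∂F)) := by
  -- the total capacity is a partial sum of one sequence of independent variables
  obtain ⟨e, he, hsum⟩ := exists_pair_enumeration
  let X : ℕ → Ω → ℝ := fun k => C (e k).1.1 (e k).1.2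
  have hX : ∀ k, HasLaw (X k) F μ := fun k => hC_law _ _ (e k).2
  have hint : Integrable (X 0) μ := by
    have := (hX 0).map_eq ▸ hF_int
    exact (integrable_map_measure (by fun_prop) (hX 0).aemeasurable).1 this
  have hslln := strong_law_ae_real X hint (fun k l hkl => hC_indep.indepFun (he.ne hkl))
    fun k => ⟨(hX k).aemeasurable, (hX 0).aemeasurable, (hX k).map_eq.trans (hX 0).map_eq.symm⟩
  rw [(hX 0).integral_eq] at hslln
  filter_upwards [hslln] with ω hω
  have hchoose : Tendsto (fun n : ℕ => n.choose 2) atTop atTop := by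
    refine tendsto_atTop_mono' _ ?_ (tendsto_sub_atTop_nat 1)
    filter_upwards [eventually_ge_atTop 2] with n hn
    rw [Nat.choose_two_right, Nat.le_div_iff_mul_le two_pos, mul_comm]
    exact Nat.mul_le_mul_right _ hn
  refine (hω.comp hchoose).congr fun n => ?_
  simp only [Function.comp_apply, X]
  rw [hsum (fun q => C q.1.1 q.1.2 ω) n]
  congr 1
  refine Finset.sum_congr rfl fun j _ => Finset.sum_congr rfl fun i hi => ?_
  rw [dif_pos (Finset.mem_range.1 hi)]

/-! ### Lower bound: superposing packings of level graphs -/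

/-- An integrable nonnegative distribution has nonnegative simple functions below the identity
with mean arbitrarily close to its own. -/
lemma exists_simpleFunc_le_id_integral_gt {F : Measure ℝ} [IsProbabilityMeasure F]
    (hF_nonneg : ∀ᵐ x ∂F, 0 ≤ x) (hF_int : Integrable (fun x : ℝ => x) F) {ε : ℝ} (hε : 0 < ε) :
    ∃ φ : SimpleFunc ℝ ℝ, (∀ x, 0 ≤ φ x) ∧ (∀ x, 0 ≤ x → φ x ≤ x) ∧
      ∫ x, x ∂F - ε < ∑ r ∈ φ.range, r * F.real (φ ⁻¹' {r}) := by
  have hlin := ofReal_integral_eq_lintegral_ofReal hF_int hF_nonneg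
  rcases le_or_gt (∫ x, x ∂F) 0 with hI | hI
  · refine ⟨0, by simp, by simp, ?_⟩
    refine lt_of_lt_of_le (by linarith) (Finset.sum_nonneg fun r hr => ?_)
    obtain ⟨x, rfl⟩ := SimpleFunc.mem_range.1 hr
    simp
  have hlt : ENNReal.ofReal (∫ x, x ∂F - ε) < ∫⁻ x, ENNReal.ofReal x ∂F := by
    rw [← hlin]
    exact (ENNReal.ofReal_lt_ofReal_iff hI).2 (by linarith)
  rw [lintegral_eq_nnreal] at hlt
  obtain ⟨φ, hlt⟩ := lt_iSup_iff.1 hlt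
  obtain ⟨hφ, hlt⟩ := lt_iSup_iff.1 hlt
  refine ⟨φ.map (fun x : NNReal => (x : ℝ)), fun x => by simp, fun x hx => ?_, ?_⟩
  · have := hφ x
    rw [← ENNReal.ofReal_coe_nnreal] at this
    simpa using (ENNReal.ofReal_le_ofReal_iff hx).1 this
  · have h1 : Integrable (φ.map (fun x : NNReal => (x : ℝ))) F :=
      SimpleFunc.integrable_of_isFiniteMeasure _
    have h2 := SimpleFunc.integral_eq_sum _ h1
    simp only [smul_eq_mul] at h2
    simp_rw [mul_comm _ (F.real _)]
    rw [← h2]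
    have h3 := ofReal_integral_eq_lintegral_ofReal h1 (ae_of_all _ fun x => by simp)
    rw [← SimpleFunc.lintegral_eq_lintegral] at hlt
    have h4 : ENNReal.ofReal (∫ x, x ∂F - ε) <
        ENNReal.ofReal (∫ x, φ.map (fun x : NNReal => (x : ℝ)) x ∂F) := by
      rw [h3]
      simpa using hlt
    exact lt_of_not_ge fun h => h4.not_ge (ENNReal.ofReal_le_ofReal h)

lemma ae_capacities_nonneg {Ω : Type*} [MeasurableSpace Ω] {μ : Measure Ω} {F : Measure ℝ}
    (hF_nonneg : ∀ᵐ x ∂F, 0 ≤ x) {C : ℕ → ℕ → Ω → ℝ}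
    (hC_law : ∀ i j : ℕ, i < j → HasLaw (C i j) F μ) :
    ∀ᵐ ω ∂μ, ∀ i j : ℕ, i < j → 0 ≤ C i j ω := by
  refine ae_all_iff.2 fun i => ae_all_iff.2 fun j => eventually_imp_distrib_left.2 fun hij => ?_
  have := (hC_law i j hij).map_eq ▸ hF_nonneg
  exact ae_of_ae_map (hC_law i j hij).aemeasurable this

/-- Almost surely, the packing value is eventually at least `(E[C] / 2 - ε) n`: pack trees
separately into the random graphs on which a simple function of the capacities is constant. -/
lemma ae_eventually_le_treePackingValue {Ω : Type*} [MeasurableSpace Ω] {μ : Measure Ω}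
    [IsProbabilityMeasure μ] {F : Measure ℝ} [IsProbabilityMeasure F]
    (hF_nonneg : ∀ᵐ x ∂F, 0 ≤ x) (hF_int : Integrable (fun x : ℝ => x) F)
    {C : ℕ → ℕ → Ω → ℝ} (hC_law : ∀ i j : ℕ, i < j → HasLaw (C i j) F μ)
    (hC_meas : ∀ i j : ℕ, i < j → Measurable (C i j))
    (hC_indep : iIndepFun (fun p : {p : ℕ × ℕ // p.1 < p.2} => C p.1.1 p.1.2) μ)
    {ε : ℝ} (hε : 0 < ε) :
    ∀ᵐ ω ∂μ, ∀ᶠ n : ℕ in atTop,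
      ((∫ x, x ∂F) / 2 - ε) * n ≤ treePackingValue n (fun i j => C i j ω) := by
  classical
  obtain ⟨φ, hφ0, hφle, hφint⟩ := exists_simpleFunc_le_id_integral_gt hF_nonneg hF_int hε
  have hr0 : ∀ r ∈ φ.range, 0 ≤ r := fun r hr => by
    obtain ⟨x, rfl⟩ := SimpleFunc.mem_range.1 hr
    exact hφ0 x
  -- the error allowed on each level, so that the weighted errors add up to at most `ε / 2`
  obtain ⟨η, hη, hηε⟩ : ∃ η : ℝ, 0 < η ∧ (∑ r ∈ φ.range, r) * η ≤ ε / 2 := by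
    have hs : 0 ≤ ∑ r ∈ φ.range, r := Finset.sum_nonneg hr0
    refine ⟨ε / 2 / (∑ r ∈ φ.range, r + 1), by positivity, ?_⟩
    rw [mul_div_assoc', div_le_iff₀ (by positivity)]
    nlinarith
  let E : ℝ → {p : ℕ × ℕ // p.1 < p.2} → Set Ω := fun r q => C q.1.1 q.1.2 ⁻¹' (φ ⁻¹' {r})
  have hE : ∀ r q, MeasurableSet (E r q) := fun r q =>
    hC_meas _ _ q.2 (φ.measurableSet_fiber r)
  have hind : ∀ r, iIndepSet (E r) μ := fun r =>
    (iIndepSet_iff_meas_biInter (hE r)).2 fun s =>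
      hC_indep.measure_inter_preimage_eq_mul s fun q _ => φ.measurableSet_fiber r
  have hp : ∀ r q, μ.real (E r q) = F.real (φ ⁻¹' {r}) := fun r q => by
    rw [measureReal_def, measureReal_def, ← (hC_law _ _ q.2).map_eq,
      Measure.map_apply (hC_meas _ _ q.2) (φ.measurableSet_fiber r)]
  have hlevels := (ae_ball_iff φ.range.countable_toSet).2 fun r _ =>
    ae_eventually_exists_tree_packing (hE r) (hind r) (hp r) hη
  have hnonneg := ae_capacities_nonneg hF_nonneg hC_law
  filter_upwards [hlevels, hnonneg] with ω hω hω0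
  have hω := (Filter.eventually_all_finset φ.range).2 hω
  filter_upwards [hω, eventually_ge_atTop 2] with n hn hn2
  have hn : ∀ r, ∃ lam : SpanningTree n → ℝ, r ∈ φ.range → (∀ T, 0 ≤ lam T) ∧
      (F.real (φ ⁻¹' {r}) / 2 - η) * n ≤ ∑ T, lam T ∧
      ∀ a b : Fin n, ∑ T : SpanningTree n with T.1.Adj a b, lam T ≤
        if (eventGraph (E r) n ω).Adj a b then 1 else 0 := fun r => by
    by_cases hr : r ∈ φ.range
    · obtain ⟨lam, h⟩ := hn r hr
      exact ⟨lam, fun _ => h⟩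
    · exact ⟨0, fun h => absurd h hr⟩
  choose lam hlam using hn
  have hpack : IsTreePacking n (fun i j => C i j ω) fun T => ∑ r ∈ φ.range, r * lam r T := by
    refine ⟨fun i j hij => ?_, fun T => Finset.sum_nonneg fun r hr =>
      mul_nonneg (hr0 r hr) ((hlam r hr).1 T)⟩
    have hij' : (i : ℕ) < j := hij
    rw [Finset.sum_comm]
    calc ∑ r ∈ φ.range, ∑ T : SpanningTree n with T.1.Adj i j, r * lam r T
        ≤ ∑ r ∈ φ.range, if φ (C i j ω) = r then r else 0 := by
          refine Finset.sum_le_sum fun r hr => ?_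
          rw [← Finset.mul_sum]
          refine (mul_le_mul_of_nonneg_left ((hlam r hr).2.2 i j) (hr0 r hr)).trans (le_of_eq ?_)
          have : (eventGraph (E r) n ω).Adj i j ↔ φ (C i j ω) = r := by
            simp [eventGraph, E, sortedPair, hij'.ne, hij'.le]
          simp [this]
      _ = φ (C i j ω) := by simp
      _ ≤ C i j ω := hφle _ (hω0 i j hij')
  have hle : ∑ T, ∑ r ∈ φ.range, r * lam r T ≤ treePackingValue n fun i j => C i j ω :=
    (isGreatest_treePackingValue n hn2 _ fun i j hij _ => hω0 i j hij).2 ⟨_, hpack, rfl⟩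
  refine le_trans ?_ hle
  rw [Finset.sum_comm]
  have hsum : ∑ r ∈ φ.range, r * ((F.real (φ ⁻¹' {r}) / 2 - η) * n) ≤
      ∑ r ∈ φ.range, ∑ T, r * lam r T := by
    refine Finset.sum_le_sum fun r hr => ?_
    rw [← Finset.mul_sum]
    exact mul_le_mul_of_nonneg_left (hlam r hr).2.1 (hr0 r hr)
  refine le_trans ?_ hsum
  have : ∑ r ∈ φ.range, r * ((F.real (φ ⁻¹' {r}) / 2 - η) * n) =
      ((∑ r ∈ φ.range, r * F.real (φ ⁻¹' {r})) / 2 - (∑ r ∈ φ.range, r) * η) * n := by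
    rw [Finset.sum_div, Finset.sum_mul, ← Finset.sum_sub_distrib, Finset.sum_mul]
    exact Finset.sum_congr rfl fun r _ => by ring
  rw [this]
  exact mul_le_mul_of_nonneg_right (by linarith) (Nat.cast_nonneg n)

lemma treePackingValue_congr {n : ℕ} {c d : ℕ → ℕ → ℝ} (h : ∀ i j, i < j → c i j = d i j) :
    treePackingValue n c = treePackingValue n d := by
  have : ∀ lam, IsTreePacking n c lam ↔ IsTreePacking n d lam := fun lam => by
    unfold IsTreePacking
    refine and_congr_left fun _ => forall_congr' fun i => forall_congr' fun j =>
      forall_congr' fun hij => ?_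
    rw [h i j hij]
  simp only [treePackingValue, treePackingValues, this]

/-! ### The limit -/

theorem mainTheorem2 {Ω : Type*} [MeasurableSpace Ω] (μ : Measure Ω) [IsProbabilityMeasure μ]
    (F : Measure ℝ) [IsProbabilityMeasure F]
    (hF_nonneg : ∀ᵐ x ∂F, 0 ≤ x)
    (hF_int : Integrable (fun x : ℝ => x) F)
    (hF_pos : 0 < ∫ x, x ∂F)
    (C : ℕ → ℕ → Ω → ℝ)
    (hC_law : ∀ i j : ℕ, i < j → HasLaw (C i j) F μ)
    (hC_indep : iIndepFun (fun p : {p : ℕ × ℕ // p.1 < p.2} => C p.1.1 p.1.2) μ) :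
    ∀ᵐ ω ∂μ, Tendsto (fun n : ℕ => treePackingValue n (fun i j => C i j ω) / (n : ℝ)) atTop
      (𝓝 ((∫ x, x ∂F) / 2)) := by
  classical
  -- measurable versions of the capacities
  let C' : ℕ → ℕ → Ω → ℝ := fun i j =>
    if h : i < j then (hC_law i j h).aemeasurable.mk (C i j) else 0
  have hCC' : ∀ i j, i < j → C i j =ᵐ[μ] C' i j := fun i j h => by
    simp only [C', dif_pos h]
    exact (hC_law i j h).aemeasurable.ae_eq_mk
  have hC'_meas : ∀ i j, i < j → Measurable (C' i j) := fun i j h => by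
    simp only [C', dif_pos h]
    exact (hC_law i j h).aemeasurable.measurable_mk
  have hC'_law : ∀ i j, i < j → HasLaw (C' i j) F μ := fun i j h =>
    (hC_law i j h).congr (hCC' i j h).symm
  have hC'_indep : iIndepFun (fun p : {p : ℕ × ℕ // p.1 < p.2} => C' p.1.1 p.1.2) μ :=
    hC_indep.congr fun q => hCC' _ _ q.2
  have hall : ∀ᵐ ω ∂μ, ∀ i j, i < j → C i j ω = C' i j ω :=
    ae_all_iff.2 fun i => ae_all_iff.2 fun j => eventually_imp_distrib_left.2 fun h => hCC' i j h
  have hnonneg := ae_capacities_nonneg hF_nonneg hC_law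
  have hlower := ae_all_iff.2 fun k : ℕ => ae_eventually_le_treePackingValue hF_nonneg hF_int
    hC'_law hC'_meas hC'_indep (ε := 1 / ((k : ℝ) + 1)) (by positivity)
  filter_upwards [hall, hnonneg, hlower, ae_tendsto_sum_capacities hF_int hC_law hC_indep]
    with ω hω hω0 hωl hωu
  rw [tendsto_order]
  constructor
  · intro a ha
    obtain ⟨k, hk⟩ := exists_nat_one_div_lt (sub_pos.2 ha)
    filter_upwards [hωl k, eventually_gt_atTop 0] with n hn hn0
    have hn0' : (0 : ℝ) < n := by exact_mod_cast hn0
    rw [treePackingValue_congr hω, lt_div_iff₀ hn0']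
    exact lt_of_lt_of_le (mul_lt_mul_of_pos_right (by linarith) hn0') hn
  · intro a ha
    filter_upwards [(tendsto_order.1 hωu).2 (2 * a) (by linarith), eventually_ge_atTop 2]
      with n hn hn2
    have hn2' : (2 : ℝ) ≤ n := by exact_mod_cast hn2
    obtain ⟨lam, hlam, hval⟩ :=
      (isGreatest_treePackingValue n hn2 (fun i j => C i j ω) fun i j hij _ => hω0 i j hij).1
    have h1 := sub_one_mul_sum_le_of_isTreePacking hlam
    rw [← hval] at h1
    rw [Nat.cast_choose_two, div_lt_iff₀ (by nlinarith)] at hn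
    rw [div_lt_iff₀ (by linarith)]
    have h2 : ((n : ℝ) - 1) * treePackingValue n (fun i j => C i j ω) < ((n : ℝ) - 1) * (a * n) :=
      by linarith
    exact lt_of_mul_lt_mul_left h2 (by linarith)
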